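/- Let $G=(V,E)$ be a finite simple graph on $n$ vertices and, for $c\in\mathbb R^{E}$, let $P(G,c)$ be the problem of finding a positive semidefinite matrix $X\in\mathbb R^{V\times V}$ with $X[i,i]=1$ for all $i\in V$ and $X[i,j]=c(ij)$ for all $ij\in E$. For $\omega\in\mathbb R^{V\cup E}$ let $\Omega$ be the symmetric matrix with diagonal entries $\omega(i)$, with entries $\omega(ij)/2$ at the positions of the edges $ij$, and with all other entries $0$. When $P(G,c)$ is feasible, let $\mathrm{sd}(G,c)$ be the smallest $k\ge 0$ for which there are $\omega^1,\dots,\omega^k\in\mathbb R^{V\cup E}$ such that, with $\mathcal V^j=\{x\in\mathbb R^V: x^{\top}\Omega^i x=0\ (i=1,\dots,j)\}$ (so $\mathcal V^0=\mathbb R^V$), 1. $x^\top\Omega^j x\ge 0$ for all $x\in\mathcal V^{j-1}$ and $j=1,\dots,k$; 2. $\sum_{i\in V}\omega^j(i)+\sum_{ij\in E}\omega^j(ij)c(ij)\le 0$ for $j=1,\dots,k$; 3. $\dim\mathcal V^k$ is the rank of a relative interior point of the feasible set of $P(G,c)$. (Thus $\mathrm{sd}(G,c)=0$ if and only if $P(G,c)$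 has a positive definite solution.) The singularity degree $\mathrm{sd}(G)$ is the maximum of $\mathrm{sd}(G,c)$ over all $c$ for which $P(G,c)$ is feasible. For every integer $n\ge 4$ there is a graph $G$ on $n$ vertices whose treewidth is exactly $3$ and whose singularity degree satisfies $\mathrm{sd}(G)\ge\lfloor (n-1)/3\rfloor$. In particular $\mathrm{sd}$ admits no sublinear bound in the number of vertices: there is no function $f:\mathbb N\to\mathbb R$ with $f(n)=o(n)$ as $n\to\infty$ such that $\mathrm{sd}(G)\le f(n)$ for all $n$ and all graphs $G$ on $n$ vertices. -/

import Mathlib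

namespace PSDCompletion

open Matrix
open scoped Classical

section Treewidth

/-- A tree decomposition of `G` whose tree has the nodes `0, …, m - 1`: every vertex and every edge
of `G` lies in a bag, and for each vertex the nodes whose bags contain it induce a connected
subgraph of the tree. -/
structure TreeDecomposition {V : Type*} (G : SimpleGraph V) (m : ℕ) where
  tree : SimpleGraph (Fin m)
  isTree : tree.IsTree
  bag : Fin m → Finset V
  vertex_mem : ∀ v : V, ∃ t, v ∈ bag t
  edge_mem : ∀ u v : V, G.Adj u v → ∃ t, u ∈ bag t ∧ v ∈ bag t
  connected : ∀ v : V, (tree.induce {t | v ∈ bag t}).Connected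

/-- The treewidth of a (nonempty, finite) graph: the least `w` such that some tree decomposition
has all its bags of size at most `w + 1`. -/
noncomputable def treewidth {V : Type*} (G : SimpleGraph V) : ℕ :=
  sInf {w : ℕ | ∃ (m : ℕ) (D : TreeDecomposition G m), ∀ t, (D.bag t).card ≤ w + 1}

end Treewidth

section SingularityDegree

variable {V : Type*} [Fintype V]

/-- The elliptope: positive semidefinite matrices with unit diagonal. -/
def elliptope (V : Type*) [Fintype V] : Set (Matrix V V ℝ) :=
  {X | X.PosSemidef ∧ ∀ i, X i i = 1}

/-- The feasible set of the completion problem `P(G, c)`: positive semidefinite matrices with unit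
diagonal whose entry at each edge `ij` of `G` equals `c(ij)`. -/
def feasibleSet (G : SimpleGraph V) (c : G.edgeSet → ℝ) : Set (Matrix V V ℝ) :=
  {X | X ∈ elliptope V ∧
    ∀ (i j : V) (h : G.Adj i j), X i j = c ⟨s(i, j), G.mem_edgeSet.2 h⟩}

/-- The coordinate shadow `𝓔(G)` of the elliptope: the edge weights `c` for which `P(G, c)` is
feasible. Such weights automatically take values in `[-1, 1]`. -/
def coordinateShadow (G : SimpleGraph V) : Set (G.edgeSet → ℝ) :=
  {c | (feasibleSet G c).Nonempty}

/-- The matrix `Ω = ∑ i, ω(i) E_ii + ∑ ij, ω(ij) E_ij` of `ω ∈ ℝ^(V ∪ E)`, where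
`E_ij = (e_i e_jᵀ + e_j e_iᵀ) / 2`. -/
noncomputable def stressMatrix (G : SimpleGraph V) (ω : V ⊕ G.edgeSet → ℝ) : Matrix V V ℝ :=
  Matrix.of fun i j =>
    if i = j then ω (Sum.inl i)
    else if h : G.Adj i j then ω (Sum.inr ⟨s(i, j), G.mem_edgeSet.2 h⟩) / 2
    else 0

/-- The objective value `∑ i, ω(i) + ∑ ij, ω(ij) c(ij)` of the dual problem. -/
noncomputable def dualValue (G : SimpleGraph V) (c : G.edgeSet → ℝ) (ω : V ⊕ G.edgeSet → ℝ) : ℝ :=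
  ∑ i : V, ω (Sum.inl i) + ∑ e : G.edgeSet, ω (Sum.inr e) * c e

/-- For a sequence `Y¹, …, Yᵏ` of matrices (indexed from `0` here), the set
`𝒱ʲ = {x | xᵀ Yⁱ x = 0 for i = 1, …, j}`; so `𝒱⁰` is the whole space. For nested PSD sequences
`𝒱ʲ` is a linear subspace. -/
def nullSet {k : ℕ} (Y : Fin k → Matrix V V ℝ) (j : ℕ) : Set (V → ℝ) :=
  {x | ∀ i : Fin k, (i : ℕ) < j → x ⬝ᵥ (Y i *ᵥ x) = 0}

/-- The sequence `Y¹, …, Yᵏ` is nested PSD: each `Yⁱ` is positive semidefinite on `𝒱ⁱ⁻¹`. -/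
def IsNestedPSD {k : ℕ} (Y : Fin k → Matrix V V ℝ) : Prop :=
  ∀ i : Fin k, ∀ x ∈ nullSet Y i, 0 ≤ x ⬝ᵥ (Y i *ᵥ x)

/-- `ω¹, …, ωᵏ` is a complete facial reduction sequence for `P(G, c)`: the matrices `Ωʲ` are nested
PSD, each `ωʲ` has dual value at most `0`, and the rank `n - dim 𝒱ᵏ` of the sequence is `n - s`,
where `s` is the rank of a (relative) interior point of the feasible set. There is no sign
condition on the `ωʲ` because all the constraints of `P(G, c)` are equations. -/
structure IsFacialReduction (G : SimpleGraph V) (c : G.edgeSet → ℝ) {k : ℕ}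
    (ω : Fin k → V ⊕ G.edgeSet → ℝ) : Prop where
  nested : IsNestedPSD fun j => stressMatrix G (ω j)
  dualValue_nonpos : ∀ j, dualValue G c (ω j) ≤ 0
  rank_eq : ∃ X ∈ intrinsicInterior ℝ (feasibleSet G c),
    Set.finrank ℝ (nullSet (fun j => stressMatrix G (ω j)) k) = X.rank

/-- The singularity degree `sd(G, c)` of `P(G, c)`: the smallest length of a complete facial
reduction sequence. Such sequences exist whenever `P(G, c)` is feasible, and the empty sequence is
one exactly if `P(G, c)` has a positive definite solution. -/
noncomputable def sdWeight (G : SimpleGraph V) (c : G.edgeSet → ℝ) : ℕ :=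
  sInf {k : ℕ | ∃ ω : Fin k → V ⊕ G.edgeSet → ℝ, IsFacialReduction G c ω}

/-- The singularity degree `sd(G)`: the largest value of `sd(G, c)` over the feasible edge weights
`c ∈ 𝓔(G)`. These values are at most the number of vertices. -/
noncomputable def sd (G : SimpleGraph V) : ℕ :=
  sSup {d : ℕ | ∃ c ∈ coordinateShadow G, d = sdWeight G c}

end SingularityDegree

end PSDCompletion

/-!
The lower bound comes from a chain of triangles glued along a hub: the weights force the last
vertices of all the triangles to be represented by the same unit vector as the hub, but this is only
deduced one triangle after the other. Facial reduction has to follow that order. The vectors of a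
Gram decomposition of a feasible matrix survive every step and lie in the radical of every stress
on the current subspace. As a stress is supported on the edges, the relations this gives show that
no stress sees the triangle `i + 1` as long as the vector `flexVec i` has survived. Hence each step
removes at most one of these vectors, none of which lies in the range of a feasible matrix.

As `sd` is defined by an infimum and a supremum of natural numbers, the bound also needs that
sequences exist and have bounded length: while the range of a relative interior point `X₀` is
properly contained in the current subspace `W`, the diagonal and edge entries of `X₀` are a relative
boundary point of the cone of those of the positive semidefinite matrices with range in `W`, and a
supporting hyperplane is a further step.
-/

namespace PSDCompletion

open Matrix
open scoped Classical

section Helly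

variable {T : Type*} {G : SimpleGraph T}

/-- Convexity of a set of vertices: it contains every path between two of its members. In a tree
these are the vertex sets of subtrees. -/
def PathClosed (G : SimpleGraph T) (S : Set T) : Prop :=
  ∀ ⦃u v : T⦄ (p : G.Walk u v), p.IsPath → u ∈ S → v ∈ S → ∀ x ∈ p.support, x ∈ S

theorem PathClosed.inter {S S' : Set T} (h : PathClosed G S) (h' : PathClosed G S') :
    PathClosed G (S ∩ S') := fun _ _ p hp hu hv x hx =>
  ⟨h p hp hu.1 hv.1 x hx, h' p hp hu.2 hv.2 x hx⟩

theorem pathClosed_of_connected_induce (hG : G.IsAcyclic) {S : Set T}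
    (hS : (G.induce S).Connected) : PathClosed G S := by
  intro u v p hp hu hv x hx
  obtain ⟨q, hq⟩ := (hS.preconnected ⟨u, hu⟩ ⟨v, hv⟩).exists_isPath
  let f : G.induce S →g G := (SimpleGraph.Embedding.induce S).toHom
  let q' : G.Walk u v := q.map f
  have hq' : q'.IsPath := hq.map Subtype.val_injective
  have hpq : p = q' :=
    congrArg Subtype.val ((hG.subsingleton_path u v).elim ⟨p, hp⟩ ⟨q', hq'⟩)
  have hx' : x ∈ q.support.map f := q.support_map f ▸ (hpq ▸ hx : x ∈ q'.support)
  obtain ⟨y, -, rfl⟩ := List.mem_map.1 hx'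
  exact y.2

theorem exists_median {u v w : T} {p : G.Walk u v} (hp : p.IsPath) {q : G.Walk w u}
    (hq : q.IsPath) :
    ∃ m ∈ p.support, m ∈ q.support ∧
      ∃ s : G.Walk w v, s.IsPath ∧ m ∈ s.support ∧ s.support ⊆ q.support ++ p.support := by
  induction q with
  | nil => exact ⟨_, p.start_mem_support, by simp, p, hp, p.start_mem_support, by simp⟩
  | @cons w w' u h q ih =>
    rw [SimpleGraph.Walk.cons_isPath_iff] at hq
    by_cases hwp : w ∈ p.support
    · exact ⟨w, hwp, by simp, p.dropUntil w hwp, hp.dropUntil hwp, by simp,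
        List.subset_append_of_subset_right _ (p.support_dropUntil_subset_support hwp)⟩
    · obtain ⟨m, hmp, hmq, s, hs, hms, hsub⟩ := ih hp hq.1
      have hws : w ∉ s.support := fun hw => by simpa [hq.2, hwp] using hsub hw
      exact ⟨m, hmp, by simp [hmq], s.cons h, by simp [hs, hws], by simp [hms],
        by simpa using List.cons_subset_cons _ hsub⟩

theorem helly_three (hG : G.IsTree) {A B C : Set T} (hA : PathClosed G A) (hB : PathClosed G B)
    (hC : PathClosed G C) (hAB : (A ∩ B).Nonempty) (hAC : (A ∩ C).Nonempty)
    (hBC : (B ∩ C).Nonempty) : (A ∩ B ∩ C).Nonempty := by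
  obtain ⟨u, huA, huB⟩ := hAB
  obtain ⟨v, hvB, hvC⟩ := hBC
  obtain ⟨w, hwA, hwC⟩ := hAC
  obtain ⟨p, hp⟩ := (hG.connected.preconnected u v).exists_isPath
  obtain ⟨q, hq⟩ := (hG.connected.preconnected w u).exists_isPath
  obtain ⟨m, hmp, hmq, s, hs, hms, -⟩ := exists_median hp hq
  exact ⟨m, ⟨hA q hq hwA huA m hmq, hB p hp huB hvB m hmp⟩, hC s hs hwC hvC m hms⟩

theorem helly (hG : G.IsTree) {ι : Type*} {s : Finset ι} (hs : s.Nonempty) {A : ι → Set T}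
    (hA : ∀ i ∈ s, PathClosed G (A i)) (hne : ∀ i ∈ s, ∀ j ∈ s, (A i ∩ A j).Nonempty) :
    ∃ x, ∀ i ∈ s, x ∈ A i := by
  induction hs using Finset.Nonempty.cons_induction generalizing A with
  | singleton a =>
    obtain ⟨x, hx, -⟩ := hne a (by simp) a (by simp)
    exact ⟨x, by simpa using hx⟩
  | cons a s has hs ih =>
    simp only [Finset.forall_mem_cons] at hA hne
    have hne' : ∀ i ∈ s, ∀ j ∈ s, ((A i ∩ A a) ∩ (A j ∩ A a)).Nonempty := fun i hi j hj => by
      rw [← Set.inter_inter_distrib_right]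
      exact helly_three hG (hA.2 i hi) (hA.2 j hj) hA.1 ((hne.2 i hi).2 j hj) (hne.2 i hi).1
        (hne.2 j hj).1
    obtain ⟨x, hx⟩ := ih (A := fun i => A i ∩ A a) (fun i hi => (hA.2 i hi).inter hA.1) hne'
    obtain ⟨i, hi⟩ := hs
    exact ⟨x, (Finset.forall_mem_cons _ _).2 ⟨(hx i hi).2, fun j hj => (hx j hj).1⟩⟩

end Helly

section TreewidthBounds

variable {V : Type*} {G : SimpleGraph V}

theorem TreeDecomposition.exists_subset_bag_of_isClique {m : ℕ} (D : TreeDecomposition G m)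
    {s : Finset V} (hne : s.Nonempty) (hs : G.IsClique s) : ∃ t, s ⊆ D.bag t := by
  refine helly (A := fun v => {t | v ∈ D.bag t}) D.isTree hne
    (fun v _ => pathClosed_of_connected_induce D.isTree.isAcyclic (D.connected v)) ?_
  intro u hu v hv
  obtain rfl | huv := eq_or_ne u v
  · simpa [Set.Nonempty] using D.vertex_mem u
  · exact D.edge_mem u v (hs hu hv huv)

theorem isTree_pathGraph (m : ℕ) : (SimpleGraph.pathGraph (m + 1)).IsTree := by
  refine ⟨SimpleGraph.pathGraph_connected m, SimpleGraph.isAcyclic_iff_forall_adj_isBridge.2 ?_⟩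
  have isBridge (v w : Fin (m + 1)) (hvw : (v : ℕ) + 1 = w) :
      (SimpleGraph.pathGraph (m + 1)).IsBridge s(v, w) := by
    have stays_left {x y : Fin (m + 1)}
        (q : ((SimpleGraph.pathGraph (m + 1)).deleteEdges {s(v, w)}).Walk x y) (hx : x ≤ v) :
        y ≤ v := by
      induction q with
      | nil => exact hx
      | @cons x x' y h q ih =>
        refine ih (not_lt.1 fun hlt => ?_)
        rw [SimpleGraph.deleteEdges_adj, SimpleGraph.pathGraph_adj] at h
        obtain rfl : x = v := by omega
        obtain rfl : x' = w := by omega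
        exact h.2 rfl
    rw [SimpleGraph.isBridge_iff]
    rintro ⟨p⟩
    have := stays_left p le_rfl
    omega
  intro v w h
  rcases SimpleGraph.pathGraph_adj.1 h with h | h
  · exact isBridge v w h
  · rw [Sym2.eq_swap]
    exact isBridge w v h

theorem connected_induce_pathGraph {m : ℕ} {S : Set (Fin m)} (hne : S.Nonempty)
    (hS : S.OrdConnected) : ((SimpleGraph.pathGraph m).induce S).Connected := by
  have reachable (d : ℕ) (x y : S) (h : (y.1 : ℕ) = x.1 + d) :
      ((SimpleGraph.pathGraph m).induce S).Reachable x y := by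
    induction d generalizing y with
    | zero =>
      obtain rfl : x = y := by ext; omega
      rfl
    | succ d ih =>
      obtain ⟨z, hz⟩ : ∃ z : Fin m, (z : ℕ) = x.1 + d := ⟨⟨x.1 + d, by omega⟩, rfl⟩
      have hzS : z ∈ S := hS.out x.2 y.2 ⟨by omega, by omega⟩
      refine (ih ⟨z, hzS⟩ hz).trans (SimpleGraph.Adj.reachable ?_)
      simp only [SimpleGraph.comap_adj, SimpleGraph.pathGraph_adj, Function.Embedding.subtype_apply]
      omega
  have : Nonempty S := hne.to_subtype
  refine ⟨fun x y => ?_⟩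
  rcases le_total (x.1 : ℕ) y.1 with h | h
  · exact reachable (y.1 - x.1) x y (by omega)
  · exact (reachable (x.1 - y.1) y x (by omega)).symm

theorem exists_treeDecomposition_of_path {m : ℕ} (bag : Fin (m + 1) → Finset V)
    (vertex_mem : ∀ v, ∃ t, v ∈ bag t) (edge_mem : ∀ u v, G.Adj u v → ∃ t, u ∈ bag t ∧ v ∈ bag t)
    (ordConnected : ∀ v, {t | v ∈ bag t}.OrdConnected) :
    ∃ D : TreeDecomposition G (m + 1), D.bag = bag :=
  ⟨⟨SimpleGraph.pathGraph _, isTree_pathGraph m, bag, vertex_mem, edge_mem,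
    fun v => connected_induce_pathGraph (vertex_mem v) (ordConnected v)⟩, rfl⟩

theorem TreeDecomposition.treewidth_le {m w : ℕ} (D : TreeDecomposition G m)
    (hD : ∀ t, (D.bag t).card ≤ w + 1) : treewidth G ≤ w :=
  Nat.sInf_le ⟨m, D, hD⟩

theorem card_le_treewidth_add_one_of_isClique [Finite V] {s : Finset V} (hs : G.IsClique s) :
    s.card ≤ treewidth G + 1 := by
  have := Fintype.ofFinite V
  obtain ⟨D₀, -⟩ := exists_treeDecomposition_of_path (G := G) (m := 0) (fun _ => Finset.univ)
    (by simp) (by simp) (by simp [Set.ordConnected_univ])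
  obtain ⟨m, D, hD⟩ : treewidth G ∈ {w | ∃ m, ∃ D : TreeDecomposition G m, ∀ t,
      (D.bag t).card ≤ w + 1} :=
    Nat.sInf_mem ⟨Fintype.card V, 1, D₀, fun t => (Finset.card_le_univ _).trans (by omega)⟩
  obtain rfl | hne := s.eq_empty_or_nonempty
  · simp
  · obtain ⟨t, ht⟩ := D.exists_subset_bag_of_isClique hne hs
    exact (Finset.card_le_card ht).trans (hD t)

end TreewidthBounds

section Stress

variable {V : Type*} {G : SimpleGraph V}

theorem isSymm_stressMatrix (ω : V ⊕ G.edgeSet → ℝ) : (stressMatrix G ω).IsSymm := by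
  ext i j
  obtain rfl | hij := eq_or_ne i j
  · rfl
  · simp only [stressMatrix, transpose_apply, of_apply, hij, hij.symm, if_false, G.adj_comm j i,
      Sym2.eq_swap (a := j)]

theorem stressMatrix_apply_eq_zero (ω : V ⊕ G.edgeSet → ℝ) {i j : V} (hij : i ≠ j)
    (h : ¬ G.Adj i j) : stressMatrix G ω i j = 0 := by
  simp [stressMatrix, hij, h]

variable (G) in
/-- The linear map `ω ↦ Ω`. -/
noncomputable def stressLinearMap : (V ⊕ G.edgeSet → ℝ) →ₗ[ℝ] Matrix V V ℝ where
  toFun := stressMatrix G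
  map_add' ω ω' := by
    ext i j
    simp only [stressMatrix, of_apply, Matrix.add_apply, Pi.add_apply]
    split_ifs <;> ring
  map_smul' r ω := by
    ext i j
    simp only [stressMatrix, of_apply, Matrix.smul_apply, Pi.smul_apply, smul_eq_mul,
      RingHom.id_apply]
    split_ifs <;> ring

theorem stressMatrix_single_inl (i : V) :
    stressMatrix G (Pi.single (Sum.inl i) 1) = Matrix.single i i 1 := by
  ext a b
  simp only [stressMatrix, Pi.single_apply, Sum.inl.injEq, reduceCtorEq, dite_eq_ite, of_apply,
    single_apply]
  grind

theorem stressMatrix_single_inr {i j : V} (h : G.Adj i j) :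
    stressMatrix G (Pi.single (Sum.inr ⟨s(i, j), h⟩) 1) =
      Matrix.single i j (1 / 2) + Matrix.single j i (1 / 2) := by
  have := h.ne
  ext a b
  simp only [stressMatrix, ne_eq, reduceCtorEq, not_false_eq_true, Pi.single_eq_of_ne,
    Pi.single_apply, Sum.inr.injEq, of_apply, one_div, Matrix.add_apply, single_apply]
  grind [SimpleGraph.adj_comm]

theorem isSymm_of_posSemidef {X : Matrix V V ℝ} (hX : X.PosSemidef) : X.IsSymm := by
  rw [IsSymm, ← conjTranspose_eq_transpose_of_trivial]
  exact hX.isHermitian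

variable [Fintype V] {c : G.edgeSet → ℝ}

variable (G) in
/-- The adjoint of `ω ↦ Ω` with respect to the trace form. On a symmetric matrix it reads off the
diagonal and the entries at the edges of `G`, so that the constraints of `P(G, c)` other than
positive semidefiniteness become one equation. -/
noncomputable def entries : Matrix V V ℝ →ₗ[ℝ] (V ⊕ G.edgeSet → ℝ) :=
  LinearMap.pi fun a =>
    traceLinearMap V ℝ ℝ ∘ₗ LinearMap.mulLeft ℝ (stressMatrix G (Pi.single a 1))

theorem entries_inl (X : Matrix V V ℝ) (i : V) : entries G X (Sum.inl i) = X i i := by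
  simp [entries, stressMatrix_single_inl, trace_single_mul]

theorem entries_inr (X : Matrix V V ℝ) {i j : V} (h : G.Adj i j) :
    entries G X (Sum.inr ⟨s(i, j), h⟩) = (X i j + X j i) / 2 := by
  simp only [entries, LinearMap.pi_apply, stressMatrix_single_inr h, one_div, LinearMap.coe_comp,
    Function.comp_apply, LinearMap.mulLeft_apply, add_mul, traceLinearMap_apply, trace_add,
    trace_single_mul, smul_eq_mul]
  ring

theorem dotProduct_entries (ω : V ⊕ G.edgeSet → ℝ) (X : Matrix V V ℝ) :
    ω ⬝ᵥ entries G X = trace (stressMatrix G ω * X) := by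
  let pairing := traceLinearMap V ℝ ℝ ∘ₗ LinearMap.mulRight ℝ X ∘ₗ stressLinearMap G
  exact (dotProduct_comm _ _).trans
    (LinearMap.congr_fun ((dotProductEquiv ℝ (V ⊕ G.edgeSet)).apply_symm_apply pairing) ω)

theorem mem_feasibleSet_iff {X : Matrix V V ℝ} :
    X ∈ feasibleSet G c ↔ X.PosSemidef ∧ entries G X = Sum.elim (fun _ => 1) c := by
  simp only [feasibleSet, elliptope, Set.mem_ofPred_eq, and_assoc]
  refine and_congr_right fun hX => ?_
  have hsymm (i j : V) : (X i j + X j i) / 2 = X i j := by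
    rw [(isSymm_of_posSemidef hX).apply i j, add_self_div_two]
  constructor
  · rintro ⟨h1, hc⟩
    ext (i | ⟨e, he⟩)
    · simp [entries_inl, h1]
    · induction e with
      | _ i j => simpa [entries_inr _ (G.mem_edgeSet.1 he), hsymm] using hc i j he
  · intro h
    refine ⟨fun i => by simpa [entries_inl] using congrFun h (Sum.inl i), fun i j hij => ?_⟩
    simpa [entries_inr _ hij, hsymm] using congrFun h (Sum.inr ⟨s(i, j), hij⟩)

theorem dualValue_eq_trace {X : Matrix V V ℝ} (hX : X ∈ feasibleSet G c)
    (ω : V ⊕ G.edgeSet → ℝ) : dualValue G c ω = trace (stressMatrix G ω * X) := by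
  rw [← dotProduct_entries, (mem_feasibleSet_iff.1 hX).2]
  simp [dualValue, dotProduct, Fintype.sum_sum_type]

theorem trace_mul_vecMulVec_self (M : Matrix V V ℝ) (x : V → ℝ) :
    trace (M * vecMulVec x x) = x ⬝ᵥ (M *ᵥ x) := by
  rw [mul_vecMulVec, trace_vecMulVec, dotProduct_comm]

theorem convex_feasibleSet : Convex ℝ (feasibleSet G c) := by
  intro X hX Y hY a b ha hb hab
  rw [mem_feasibleSet_iff] at hX hY ⊢
  refine ⟨(hX.1.smul ha).add (hY.1.smul hb), ?_⟩
  rw [map_add, map_smul, map_smul, hX.2, hY.2, ← add_smul, hab, one_smul]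

end Stress

section IsotropicVectors

variable {V : Type*} [Fintype V] {M : Matrix V V ℝ} {W : Submodule ℝ (V → ℝ)}

theorem dotProduct_mulVec_comm_of_isSymm (hM : M.IsSymm) (x y : V → ℝ) :
    x ⬝ᵥ (M *ᵥ y) = y ⬝ᵥ (M *ᵥ x) := by
  rw [← dotProduct_transpose_mulVec, hM.eq]

theorem dotProduct_mulVec_eq_zero_of_isotropic (hM : M.IsSymm)
    (hW : ∀ x ∈ W, 0 ≤ x ⬝ᵥ (M *ᵥ x)) {v w : V → ℝ} (hv : v ∈ W)
    (hv0 : v ⬝ᵥ (M *ᵥ v) = 0) (hw : w ∈ W) : v ⬝ᵥ (M *ᵥ w) = 0 := by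
  let B : LinearMap.BilinForm ℝ W := (Matrix.toBilin' M).restrict W
  have hB (x y : W) : B x y = (x : V → ℝ) ⬝ᵥ (M *ᵥ y) := Matrix.toBilin'_apply' M x y
  have hsymm : LinearMap.IsSymm B := ⟨fun x y => by
    simpa only [RingHom.id_apply, hB] using dotProduct_mulVec_comm_of_isSymm hM _ _⟩
  have hcs := B.apply_sq_le_of_symm (fun x => (hB x x).symm ▸ hW x x.2) hsymm ⟨v, hv⟩ ⟨w, hw⟩
  rw [hB, hB, hB, hv0, zero_mul] at hcs
  exact pow_eq_zero_iff two_ne_zero |>.1 (le_antisymm hcs (sq_nonneg _))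

theorem exists_submodule_isotropic (hM : M.IsSymm) (hW : ∀ x ∈ W, 0 ≤ x ⬝ᵥ (M *ᵥ x)) :
    ∃ W' : Submodule ℝ (V → ℝ), ∀ x, x ∈ W' ↔ x ∈ W ∧ x ⬝ᵥ (M *ᵥ x) = 0 := by
  refine ⟨{ carrier := {x | x ∈ W ∧ x ⬝ᵥ (M *ᵥ x) = 0}
            zero_mem' := ⟨W.zero_mem, zero_dotProduct _⟩
            add_mem' := ?_
            smul_mem' := fun r x hx => ⟨W.smul_mem r hx.1, by simp [mulVec_smul, hx.2]⟩ },
    fun x => Iff.rfl⟩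
  rintro x y ⟨hx, hx0⟩ ⟨hy, hy0⟩
  refine ⟨W.add_mem hx hy, ?_⟩
  rw [add_dotProduct,
    dotProduct_mulVec_eq_zero_of_isotropic hM hW hx hx0 (W.add_mem hx hy),
    dotProduct_mulVec_eq_zero_of_isotropic hM hW hy hy0 (W.add_mem hx hy), add_zero]

end IsotropicVectors

section FacialReduction

variable {V : Type*} [Fintype V]

theorem nullSet_castSucc {k : ℕ} (Y : Fin (k + 1) → Matrix V V ℝ) {j : ℕ} (hj : j ≤ k) :
    nullSet (fun i : Fin k => Y i.castSucc) j = nullSet Y j := by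
  ext x
  simp only [nullSet, Set.mem_ofPred_eq, Fin.forall_fin_succ', Fin.val_castSucc, Fin.val_last,
    hj.not_gt, false_imp_iff, and_true]

theorem mem_nullSet_succ {k : ℕ} (Y : Fin (k + 1) → Matrix V V ℝ) (x : V → ℝ) :
    x ∈ nullSet Y (k + 1) ↔
      x ∈ nullSet (fun i : Fin k => Y i.castSucc) k ∧ x ⬝ᵥ (Y (Fin.last k) *ᵥ x) = 0 := by
  simp [nullSet, Fin.forall_fin_succ']

theorem isNestedPSD_succ_iff {k : ℕ} (Y : Fin (k + 1) → Matrix V V ℝ) :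
    IsNestedPSD Y ↔ (IsNestedPSD fun i : Fin k => Y i.castSucc) ∧
      ∀ x ∈ nullSet (fun i : Fin k => Y i.castSucc) k, 0 ≤ x ⬝ᵥ (Y (Fin.last k) *ᵥ x) := by
  have hinit (i : Fin k) := nullSet_castSucc Y i.is_lt.le
  simp only [IsNestedPSD, Fin.forall_fin_succ', Fin.val_castSucc, Fin.val_last, hinit,
    nullSet_castSucc Y le_rfl]

variable (G : SimpleGraph V) (c : G.edgeSet → ℝ)

/-- `ReducesTo G c k W`: some `k` facial reduction steps for `P(G, c)` lead to the subspace `W`,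
that is, `W` is `𝒱ᵏ` for some `ω¹, …, ωᵏ` satisfying conditions 1 and 2. -/
inductive ReducesTo : ℕ → Submodule ℝ (V → ℝ) → Prop
  | zero : ReducesTo 0 ⊤
  | succ {k : ℕ} {W W' : Submodule ℝ (V → ℝ)} (hW : ReducesTo k W) (ω : V ⊕ G.edgeSet → ℝ)
      (nonneg : ∀ x ∈ W, 0 ≤ x ⬝ᵥ (stressMatrix G ω *ᵥ x)) (dualValue_nonpos : dualValue G c ω ≤ 0)
      (mem_iff : ∀ x, x ∈ W' ↔ x ∈ W ∧ x ⬝ᵥ (stressMatrix G ω *ᵥ x) = 0) : ReducesTo (k + 1) W'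

variable {G c}

theorem exists_reducesTo {k : ℕ} {ω : Fin k → V ⊕ G.edgeSet → ℝ}
    (hn : IsNestedPSD fun j => stressMatrix G (ω j)) (hd : ∀ j, dualValue G c (ω j) ≤ 0) :
    ∃ W, ReducesTo G c k W ∧ nullSet (fun j => stressMatrix G (ω j)) k = W := by
  induction k with
  | zero => exact ⟨⊤, .zero, by simp [nullSet]⟩
  | succ k ih =>
    obtain ⟨hinit, hlast⟩ := (isNestedPSD_succ_iff _).1 hn
    obtain ⟨W, hW, hnull⟩ := ih hinit fun j => hd j.castSucc
    rw [hnull] at hlast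
    obtain ⟨W', hW'⟩ := exists_submodule_isotropic (isSymm_stressMatrix _) hlast
    refine ⟨W', hW.succ _ hlast (hd _) hW', Set.ext fun x => ?_⟩
    rw [mem_nullSet_succ, hnull, SetLike.mem_coe, SetLike.mem_coe, hW']

theorem ReducesTo.exists_sequence {k : ℕ} {W : Submodule ℝ (V → ℝ)} (h : ReducesTo G c k W) :
    ∃ ω : Fin k → V ⊕ G.edgeSet → ℝ, (IsNestedPSD fun j => stressMatrix G (ω j)) ∧
      (∀ j, dualValue G c (ω j) ≤ 0) ∧ nullSet (fun j => stressMatrix G (ω j)) k = W := by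
  induction h with
  | zero => exact ⟨Fin.elim0, fun i => i.elim0, fun i => i.elim0, by simp [nullSet]⟩
  | @succ k W W' _ ω nonneg hd mem_iff ih =>
    obtain ⟨ω₀, hn₀, hd₀, hW⟩ := ih
    refine ⟨Fin.snoc ω₀ ω, (isNestedPSD_succ_iff _).2 ?_, ?_, Set.ext fun x => ?_⟩
    · simpa [Fin.snoc_castSucc, hW, hn₀] using nonneg
    · simpa [Fin.forall_fin_succ', hd] using hd₀
    · simp [mem_nullSet_succ, hW, mem_iff]

theorem ReducesTo.mem_of_sum_vecMulVec_mem {k : ℕ} {W : Submodule ℝ (V → ℝ)}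
    (h : ReducesTo G c k W) {ι : Type*} [Fintype ι] {u : ι → V → ℝ}
    (hu : ∑ a, vecMulVec (u a) (u a) ∈ feasibleSet G c) (a : ι) : u a ∈ W := by
  induction h generalizing a with
  | zero => trivial
  | @succ _ W W' _ ω nonneg hd mem_iff ih =>
    have hnonneg (a : ι) : 0 ≤ u a ⬝ᵥ (stressMatrix G ω *ᵥ u a) := nonneg _ (ih a)
    have hsum : ∑ a, u a ⬝ᵥ (stressMatrix G ω *ᵥ u a) ≤ 0 := by
      simpa [dualValue_eq_trace hu, Finset.mul_sum, trace_sum, trace_mul_vecMulVec_self] using hd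
    have hzero := (Finset.sum_eq_zero_iff_of_nonneg fun a _ => hnonneg a).1
      (hsum.antisymm (Finset.sum_nonneg fun a _ => hnonneg a))
    exact (mem_iff _).2 ⟨ih a, hzero a (Finset.mem_univ a)⟩

theorem exists_eq_sum_vecMulVec_self {V : Type*} [Finite V] {X : Matrix V V ℝ} (hX : X.PosSemidef) :
    ∃ (m : ℕ) (u : Fin m → V → ℝ), X = ∑ a, vecMulVec (u a) (u a) := by
  have := Fintype.ofFinite V
  simpa using posSemidef_iff_eq_sum_vecMulVec.1 hX

theorem ReducesTo.range_le {k : ℕ} {W : Submodule ℝ (V → ℝ)} (h : ReducesTo G c k W)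
    {X : Matrix V V ℝ} (hX : X ∈ feasibleSet G c) : LinearMap.range X.mulVecLin ≤ W := by
  obtain ⟨m, u, rfl⟩ := exists_eq_sum_vecMulVec_self (mem_feasibleSet_iff.1 hX).1
  rintro _ ⟨y, rfl⟩
  simp only [mulVecLin_apply, sum_mulVec, vecMulVec_mulVec, op_smul_eq_smul]
  exact W.sum_mem fun a _ => W.smul_mem _ (h.mem_of_sum_vecMulVec_mem hX a)

theorem exists_isFacialReduction_iff {k : ℕ} :
    (∃ ω : Fin k → V ⊕ G.edgeSet → ℝ, IsFacialReduction G c ω) ↔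
      ∃ X ∈ intrinsicInterior ℝ (feasibleSet G c),
        ReducesTo G c k (LinearMap.range X.mulVecLin) := by
  constructor
  · rintro ⟨ω, hn, hd, X, hX, hrank⟩
    obtain ⟨W, hW, hnull⟩ := exists_reducesTo hn hd
    rw [hnull, Set.finrank, Submodule.span_eq] at hrank
    obtain rfl := Submodule.eq_of_le_of_finrank_eq (hW.range_le (intrinsicInterior_subset hX))
      hrank.symm
    exact ⟨X, hX, hW⟩
  · rintro ⟨X, hX, hW⟩
    obtain ⟨ω, hn, hd, hnull⟩ := hW.exists_sequence
    refine ⟨ω, hn, hd, X, hX, ?_⟩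
    rw [hnull, Set.finrank, Submodule.span_eq]
    rfl

end FacialReduction

section Separation

theorem exists_extension_of_mem_intrinsicInterior {E : Type*} [AddCommGroup E] [Module ℝ E]
    [TopologicalSpace E] [ContinuousAdd E] [ContinuousSMul ℝ E] {s : Set E} {x y : E}
    (hx : x ∈ intrinsicInterior ℝ s) (hy : y ∈ s) : ∃ ε : ℝ, 0 < ε ∧ x + ε • (x - y) ∈ s := by
  obtain ⟨x, hxint, rfl⟩ := mem_intrinsicInterior.1 hx
  have hmem (t : ℝ) : (x : E) + t • ((x : E) - y) ∈ affineSpan ℝ s := by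
    convert AffineMap.lineMap_mem (-t) x.2 (subset_affineSpan ℝ s hy) using 1
    simp only [AffineMap.lineMap_apply, vsub_eq_sub, vadd_eq_add, neg_smul, smul_sub]
    abel
  let ray : ℝ → affineSpan ℝ s := fun t => ⟨_, hmem t⟩
  have hray : Filter.Tendsto ray (nhds 0) (nhds x) :=
    Continuous.tendsto' (Continuous.subtype_mk (by fun_prop) _) _ _ (by simp)
  have hsmall : ∀ᶠ t in nhds (0 : ℝ), (ray t : E) ∈ s :=
    hray (mem_interior_iff_mem_nhds.1 hxint)
  exact hsmall.exists_gt

theorem interior_span_preimage_nonempty {E : Type*} [NormedAddCommGroup E] [NormedSpace ℝ E]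
    [FiniteDimensional ℝ E] (C : PointedCone ℝ E) :
    (interior ((↑) ⁻¹' (C : Set E) : Set (Submodule.span ℝ (C : Set E)))).Nonempty := by
  have hzero : (0 : Submodule.span ℝ (C : Set E)) ∈ (↑) ⁻¹' (C : Set E) := C.zero_mem
  have hconv : Convex ℝ ((↑) ⁻¹' (C : Set E) : Set (Submodule.span ℝ (C : Set E))) :=
    C.convex.linear_preimage (Submodule.subtype _)
  rw [hconv.interior_nonempty_iff_affineSpan_eq_top,
    AffineSubspace.affineSpan_eq_top_iff_vectorSpan_eq_top_of_nonempty _ _ _ ⟨0, hzero⟩,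
    vectorSpan_eq_span_vsub_set_right ℝ hzero]
  simp

theorem exists_dual_nonneg_of_forall_sub_smul_notMem {E : Type*} [NormedAddCommGroup E]
    [NormedSpace ℝ E] [FiniteDimensional ℝ E] (C : PointedCone ℝ E) {b x : E} (hb : b ∈ C)
    (hx : x ∈ C) (h : ∀ δ : ℝ, 0 < δ → b - δ • x ∉ C) :
    ∃ f : E →ₗ[ℝ] ℝ, (∀ y ∈ C, 0 ≤ f y) ∧ f b ≤ 0 ∧ ∃ y ∈ C, f y ≠ 0 := by
  let L := Submodule.span ℝ (C : Set E)
  let C' : Set L := (↑) ⁻¹' (C : Set E)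
  let b' : L := ⟨b, Submodule.subset_span hb⟩
  let x' : L := ⟨x, Submodule.subset_span hx⟩
  have hb' : b' ∉ interior C' := by
    intro hmem
    have hcont : Filter.Tendsto (fun δ : ℝ => b' - δ • x') (nhds 0) (nhds b') :=
      Continuous.tendsto' (by fun_prop) _ _ (by simp)
    have hsmall : ∀ᶠ δ in nhds (0 : ℝ), b' - δ • x' ∈ C' :=
      hcont (mem_interior_iff_mem_nhds.1 hmem)
    obtain ⟨δ, hpos, hδ⟩ := hsmall.exists_gt
    exact h δ hpos hδ
  obtain ⟨f, hf0, hf⟩ := geometric_hahn_banach_of_nonempty_interior_point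
    (C.convex.linear_preimage L.subtype) hb' (interior_span_preimage_nonempty C)
  have hfb : f b' = 0 := by
    have h0 : f 0 ≤ f b' := hf 0 C.zero_mem
    have h2 : f (b' + b') ≤ f b' := hf _ (C.add_mem hb hb)
    rw [map_zero] at h0
    rw [map_add] at h2
    linarith
  obtain ⟨g, hg⟩ := LinearMap.exists_extend (-f : L →ₗ[ℝ] ℝ)
  have hgf (y : L) : g y = -f y := LinearMap.congr_fun hg y
  refine ⟨g, fun y hy => ?_, ?_, ?_⟩
  · have := hf ⟨y, Submodule.subset_span hy⟩ hy
    rw [hgf ⟨y, Submodule.subset_span hy⟩]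
    linarith
  · rw [hgf b', hfb, neg_zero]
  · by_contra! hzero
    refine hf0 (ContinuousLinearMap.coe_injective (LinearMap.ext_on
      (Submodule.span_span_coe_preimage (s := (C : Set E))) fun y hy => ?_))
    simpa [hgf] using hzero y hy

end Separation

section Existence

variable {V : Type*} [Fintype V] {G : SimpleGraph V} {c : G.edgeSet → ℝ}

theorem dotProduct_mulVec_eq_zero_of_mem_intrinsicInterior {X X₀ : Matrix V V ℝ}
    (hX₀ : X₀ ∈ intrinsicInterior ℝ (feasibleSet G c)) (hX : X ∈ feasibleSet G c) {x : V → ℝ}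
    (hx : X₀ *ᵥ x = 0) : x ⬝ᵥ (X *ᵥ x) = 0 := by
  obtain ⟨ε, hε, hext⟩ := exists_extension_of_mem_intrinsicInterior hX₀ hX
  have hext_nonneg := (mem_feasibleSet_iff.1 hext).1.dotProduct_mulVec_nonneg x
  have hX_nonneg := (mem_feasibleSet_iff.1 hX).1.dotProduct_mulVec_nonneg x
  simp only [star_trivial, add_mulVec, smul_mulVec, sub_mulVec, hx, dotProduct_smul,
    dotProduct_sub, dotProduct_add, dotProduct_zero, smul_eq_mul] at hext_nonneg hX_nonneg
  nlinarith

variable (G) in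
/-- The cone of the diagonal and edge entries of the positive semidefinite matrices whose range
lies in `W`, given by its generators `x xᵀ` with `x ∈ W`. -/
noncomputable def entriesCone (W : Submodule ℝ (V → ℝ)) : PointedCone ℝ (V ⊕ G.edgeSet → ℝ) :=
  PointedCone.hull ℝ ((fun x => entries G (vecMulVec x x)) '' W)

theorem entries_vecMulVec_mem_entriesCone {W : Submodule ℝ (V → ℝ)} {x : V → ℝ} (hx : x ∈ W) :
    entries G (vecMulVec x x) ∈ entriesCone G W :=
  PointedCone.subset_hull ⟨x, hx, rfl⟩

theorem exists_posSemidef_of_mem_entriesCone {W : Submodule ℝ (V → ℝ)}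
    {z : V ⊕ G.edgeSet → ℝ} (hz : z ∈ entriesCone G W) :
    ∃ X : Matrix V V ℝ, X.PosSemidef ∧ entries G X = z := by
  induction hz using Submodule.span_induction with
  | mem z hz =>
    obtain ⟨x, -, rfl⟩ := hz
    exact ⟨_, by simpa using posSemidef_vecMulVec_self_star x, rfl⟩
  | zero => exact ⟨0, PosSemidef.zero, map_zero _⟩
  | add z z' _ _ hz hz' =>
    obtain ⟨X, hX, rfl⟩ := hz
    obtain ⟨X', hX', rfl⟩ := hz'
    exact ⟨X + X', hX.add hX', map_add _ _ _⟩
  | smul r z _ hz =>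
    obtain ⟨X, hX, rfl⟩ := hz
    exact ⟨(r : ℝ) • X, hX.smul r.2, map_smul _ _ _⟩

theorem exists_mem_mulVec_eq_zero_of_range_lt {X : Matrix V V ℝ} {W : Submodule ℝ (V → ℝ)}
    (hlt : LinearMap.range X.mulVecLin < W) : ∃ w ∈ W, w ≠ 0 ∧ X *ᵥ w = 0 := by
  let φ : W →ₗ[ℝ] LinearMap.range X.mulVecLin := X.mulVecLin.rangeRestrict ∘ₗ W.subtype
  obtain ⟨w, hw, hw0⟩ := (Submodule.ne_bot_iff _).1
    (φ.ker_ne_bot_of_finrank_lt (Submodule.finrank_lt_finrank_of_lt hlt))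
  exact ⟨w, w.2, by simpa using hw0, congrArg Subtype.val (LinearMap.mem_ker.1 hw)⟩

theorem entries_sub_smul_notMem_entriesCone {X₀ : Matrix V V ℝ}
    (hX₀ : X₀ ∈ intrinsicInterior ℝ (feasibleSet G c)) {w : V → ℝ} (hw : w ≠ 0)
    (hXw : X₀ *ᵥ w = 0) (W : Submodule ℝ (V → ℝ)) {δ : ℝ} (hδ : 0 < δ) :
    entries G X₀ - δ • entries G (vecMulVec w w) ∉ entriesCone G W := by
  intro hmem
  obtain ⟨X, hX, heq⟩ := exists_posSemidef_of_mem_entriesCone hmem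
  have hpsd : (δ • vecMulVec w w).PosSemidef := by
    simpa using (posSemidef_vecMulVec_self_star w).smul hδ.le
  have hfeas : X + δ • vecMulVec w w ∈ feasibleSet G c :=
    mem_feasibleSet_iff.2 ⟨hX.add hpsd, by
      rw [map_add, map_smul, heq, sub_add_cancel,
        (mem_feasibleSet_iff.1 (intrinsicInterior_subset hX₀)).2]⟩
  have hzero := dotProduct_mulVec_eq_zero_of_mem_intrinsicInterior hX₀ hfeas hXw
  have hXnonneg := hX.dotProduct_mulVec_nonneg w
  simp only [star_trivial, add_mulVec, smul_mulVec, vecMulVec_mulVec, op_smul_eq_smul,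
    dotProduct_add, dotProduct_smul, smul_eq_mul] at hzero hXnonneg
  have hpos : 0 < w ⬝ᵥ w := by
    simpa using dotProduct_star_self_pos_iff.2 hw
  nlinarith [mul_pos hδ (mul_pos hpos hpos)]

-- The entries of a relative interior point lie on the relative boundary of `entriesCone G W`, so
-- a hyperplane supports the cone there without containing it.
theorem ReducesTo.exists_nonneg_of_range_lt {X₀ : Matrix V V ℝ}
    (hX₀ : X₀ ∈ intrinsicInterior ℝ (feasibleSet G c)) {k : ℕ} {W : Submodule ℝ (V → ℝ)}
    (hW : ReducesTo G c k W) (hlt : LinearMap.range X₀.mulVecLin < W) :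
    ∃ ω : V ⊕ G.edgeSet → ℝ, (∀ x ∈ W, 0 ≤ x ⬝ᵥ (stressMatrix G ω *ᵥ x)) ∧
      dualValue G c ω ≤ 0 ∧ ∃ x ∈ W, x ⬝ᵥ (stressMatrix G ω *ᵥ x) ≠ 0 := by
  have hX₀mem := intrinsicInterior_subset hX₀
  obtain ⟨w, hw, hw0, hXw⟩ := exists_mem_mulVec_eq_zero_of_range_lt hlt
  have hbC : entries G X₀ ∈ entriesCone G W := by
    obtain ⟨m, u, rfl⟩ := exists_eq_sum_vecMulVec_self (mem_feasibleSet_iff.1 hX₀mem).1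
    rw [map_sum]
    exact Submodule.sum_mem _ fun a _ =>
      entries_vecMulVec_mem_entriesCone (hW.mem_of_sum_vecMulVec_mem hX₀mem a)
  obtain ⟨f, hnonneg, hb, y, hy, hfy⟩ := exists_dual_nonneg_of_forall_sub_smul_notMem _ hbC
    (entries_vecMulVec_mem_entriesCone hw)
    fun δ hδ => entries_sub_smul_notMem_entriesCone hX₀ hw0 hXw W hδ
  obtain ⟨ω, rfl⟩ := (dotProductEquiv ℝ (V ⊕ G.edgeSet)).surjective f
  have hform (x : V → ℝ) : dotProductEquiv ℝ _ ω (entries G (vecMulVec x x)) =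
      x ⬝ᵥ (stressMatrix G ω *ᵥ x) := by
    rw [dotProductEquiv_apply_apply, dotProduct_entries, trace_mul_vecMulVec_self]
  refine ⟨ω, fun x hx => ?_, ?_, ?_⟩
  · simpa only [hform] using hnonneg _ (entries_vecMulVec_mem_entriesCone hx)
  · rwa [dualValue_eq_trace hX₀mem, ← dotProduct_entries]
  · by_contra! hzero
    refine hfy ?_
    clear hfy
    induction hy using Submodule.span_induction with
    | mem y hy =>
      obtain ⟨x, hx, rfl⟩ := hy
      exact (hform x).trans (hzero x hx)
    | zero => exact map_zero _
    | add y z _ _ hy hz => rw [map_add, hy, hz, add_zero]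
    | smul r y _ hy => exact (map_smul _ (r : ℝ) y).trans (by rw [hy, smul_zero])

theorem ReducesTo.exists_reducesTo_finrank_lt {X₀ : Matrix V V ℝ}
    (hX₀ : X₀ ∈ intrinsicInterior ℝ (feasibleSet G c)) {k : ℕ} {W : Submodule ℝ (V → ℝ)}
    (hW : ReducesTo G c k W) (hlt : LinearMap.range X₀.mulVecLin < W) :
    ∃ W', ReducesTo G c (k + 1) W' ∧ Module.finrank ℝ W' < Module.finrank ℝ W := by
  obtain ⟨ω, hnonneg, hd, x, hx, hx0⟩ := hW.exists_nonneg_of_range_lt hX₀ hlt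
  obtain ⟨W', hW'⟩ := exists_submodule_isotropic (isSymm_stressMatrix ω) hnonneg
  refine ⟨W', hW.succ ω hnonneg hd hW', Submodule.finrank_lt_finrank_of_lt ?_⟩
  exact SetLike.lt_iff_le_and_exists.2
    ⟨fun y hy => ((hW' y).1 hy).1, x, hx, fun hx' => hx0 ((hW' x).1 hx').2⟩

theorem exists_reducesTo_range {X₀ : Matrix V V ℝ}
    (hX₀ : X₀ ∈ intrinsicInterior ℝ (feasibleSet G c)) :
    ∃ k ≤ Fintype.card V, ReducesTo G c k (LinearMap.range X₀.mulVecLin) := by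
  suffices h : ∀ (d k : ℕ) (W : Submodule ℝ (V → ℝ)), ReducesTo G c k W →
      Module.finrank ℝ W = d →
      ∃ l ≤ k + d, ReducesTo G c l (LinearMap.range X₀.mulVecLin) by
    simpa using h _ 0 ⊤ .zero rfl
  intro d
  induction d using Nat.strong_induction_on with
  | _ d ih =>
    rintro k W hW rfl
    obtain heq | hlt := (hW.range_le (intrinsicInterior_subset hX₀)).eq_or_lt
    · exact ⟨k, Nat.le_add_right _ _, heq ▸ hW⟩
    · obtain ⟨W', hW', hlt'⟩ := hW.exists_reducesTo_finrank_lt hX₀ hlt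
      obtain ⟨l, hl, h⟩ := ih _ hlt' _ _ hW' rfl
      exact ⟨l, by omega, h⟩

theorem intrinsicInterior_feasibleSet_nonempty (hc : c ∈ coordinateShadow G) :
    (intrinsicInterior ℝ (feasibleSet G c)).Nonempty := by
  let : NormedAddCommGroup (Matrix V V ℝ) := Matrix.normedAddCommGroup
  let : NormedSpace ℝ (Matrix V V ℝ) := Matrix.normedSpace
  exact Set.Nonempty.intrinsicInterior convex_feasibleSet hc

theorem exists_isFacialReduction (hc : c ∈ coordinateShadow G) :
    ∃ k ≤ Fintype.card V, ∃ ω : Fin k → V ⊕ G.edgeSet → ℝ, IsFacialReduction G c ω := by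
  obtain ⟨X, hX⟩ := intrinsicInterior_feasibleSet_nonempty hc
  obtain ⟨k, hk, h⟩ := exists_reducesTo_range hX
  exact ⟨k, hk, exists_isFacialReduction_iff.2 ⟨X, hX, h⟩⟩

theorem sdWeight_le_card (hc : c ∈ coordinateShadow G) : sdWeight G c ≤ Fintype.card V :=
  have ⟨_, hk, h⟩ := exists_isFacialReduction hc
  (Nat.sInf_le h).trans hk

theorem sdWeight_le_sd (hc : c ∈ coordinateShadow G) : sdWeight G c ≤ sd G :=
  le_csSup ⟨Fintype.card V, by rintro _ ⟨c, hc, rfl⟩; exact sdWeight_le_card hc⟩ ⟨c, hc, rfl⟩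

theorem le_sdWeight (hc : c ∈ coordinateShadow G) {k : ℕ}
    (h : ∀ m, ∀ X ∈ feasibleSet G c, ReducesTo G c m (LinearMap.range X.mulVecLin) → k ≤ m) :
    k ≤ sdWeight G c := by
  obtain ⟨l, -, hl⟩ := exists_isFacialReduction hc
  have hmin : ∃ ω : Fin (sdWeight G c) → V ⊕ G.edgeSet → ℝ, IsFacialReduction G c ω :=
    Nat.sInf_mem (s := {k | ∃ ω : Fin k → V ⊕ G.edgeSet → ℝ, IsFacialReduction G c ω}) ⟨l, hl⟩
  obtain ⟨X, hX, hred⟩ := exists_isFacialReduction_iff.1 hmin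
  exact h _ X (intrinsicInterior_subset hX) hred

end Existence

section Chain

variable {k e : ℕ}

variable (k e) in
/-- A chain of `k` triangles `{3i + 1, 3i + 2, 3i + 3}`, each joined to the hub `0` at its first
vertex and to the vertex `3i` at its second one, with `e` isolated vertices appended to reach every
order. The edge `{0, 3}` only serves to make `{0, 1, 2, 3}` a clique. -/
def chainGraph : SimpleGraph (Fin (3 * k + e + 1)) :=
  SimpleGraph.fromRel fun u v => (v : ℕ) ≤ 3 * k ∧
    ((u : ℕ) % 3 = 1 ∧ ((v : ℕ) = u + 1 ∨ (v : ℕ) = u + 2) ∨ (u : ℕ) % 3 = 2 ∧ (v : ℕ) = u + 1 ∨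
      (u : ℕ) = 0 ∧ (v : ℕ) % 3 = 1 ∨ (u : ℕ) % 3 = 0 ∧ (v : ℕ) = u + 2 ∨ (u : ℕ) = 0 ∧ (v : ℕ) = 3)

theorem chainGraph_adj_iff {u v : Fin (3 * k + e + 1)} (huv : u < v) :
    (chainGraph k e).Adj u v ↔ (v : ℕ) ≤ 3 * k ∧
      ((u : ℕ) % 3 = 1 ∧ ((v : ℕ) = u + 1 ∨ (v : ℕ) = u + 2) ∨ (u : ℕ) % 3 = 2 ∧ (v : ℕ) = u + 1 ∨
        (u : ℕ) = 0 ∧ (v : ℕ) % 3 = 1 ∨ (u : ℕ) % 3 = 0 ∧ (v : ℕ) = u + 2 ∨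
        (u : ℕ) = 0 ∧ (v : ℕ) = 3) := by
  simp only [chainGraph, SimpleGraph.fromRel_adj, ne_eq, huv.ne, not_false_eq_true, true_and]
  omega

theorem treewidth_le_three_of_forall_adj {n : ℕ} {G : SimpleGraph (Fin n)}
    (hG : ∀ u v, u < v → G.Adj u v → (u : ℕ) = 0 ∨ (v : ℕ) ≤ u + 2) : treewidth G ≤ 3 := by
  let bag (t : Fin (n + 1)) : Finset (Fin n) :=
    {v | (v : ℕ) = 0 ∨ (t : ℕ) < v ∧ (v : ℕ) ≤ t + 3}
  have mem_bag (v t) : v ∈ bag t ↔ (v : ℕ) = 0 ∨ (t : ℕ) < v ∧ (v : ℕ) ≤ t + 3 := by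
    simp [bag]
  have exists_bag {u v : Fin n} (huv : u < v) (h : G.Adj u v) : ∃ t, u ∈ bag t ∧ v ∈ bag t := by
    have := hG u v huv h
    exact ⟨⟨v - 3, by omega⟩, by simp only [mem_bag]; omega⟩
  obtain ⟨D, hD⟩ := exists_treeDecomposition_of_path (G := G) bag
    (fun v => ⟨⟨v - 1, by omega⟩, by simp only [mem_bag]; omega⟩)
    (fun u v h => h.ne.lt_or_gt.elim (fun huv => exists_bag huv h)
      fun hvu => (exists_bag hvu h.symm).imp fun _ => And.symm)
    (fun v => ⟨fun s hs t ht r hr => by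
      simp only [Set.mem_ofPred_eq, Set.mem_Icc, Fin.le_def, mem_bag] at *
      omega⟩)
  refine D.treewidth_le fun t => ?_
  have hsub : (bag t).map Fin.valEmbedding ⊆ {0, (t : ℕ) + 1, (t : ℕ) + 2, (t : ℕ) + 3} := by
    intro v
    simp only [Finset.mem_map, mem_bag, Fin.valEmbedding_apply, Finset.mem_insert,
      Finset.mem_singleton, forall_exists_index, and_imp]
    omega
  rw [hD, ← Finset.card_map Fin.valEmbedding]
  exact (Finset.card_le_card hsub).trans Finset.card_le_four

theorem treewidth_chainGraph (hk : 0 < k) : treewidth (chainGraph k e) = 3 := by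
  refine (treewidth_le_three_of_forall_adj fun u v huv h => ?_).antisymm ?_
  · rw [chainGraph_adj_iff huv] at h
    omega
  · let K : Finset (Fin (3 * k + e + 1)) := Finset.univ.map (Fin.castLEEmb (n := 4) (by omega))
    have hlt (i j : Fin 4) (hij : i < j) : (chainGraph k e).Adj (Fin.castLE (by omega) i)
        (Fin.castLE (by omega) j) := by
      rw [chainGraph_adj_iff ((Fin.castLE_lt_castLE_iff _).2 hij)]
      simp only [Fin.val_castLE]
      omega
    have hK : (chainGraph k e).IsClique K := by
      intro u hu v hv huv
      obtain ⟨i, -, rfl⟩ := Finset.mem_map.1 hu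
      obtain ⟨j, -, rfl⟩ := Finset.mem_map.1 hv
      obtain hij | hij := (ne_of_apply_ne _ huv).lt_or_gt
      exacts [hlt i j hij, (hlt j i hij).symm]
    simpa [K] using card_le_treewidth_add_one_of_isClique hK

variable (e) in
/-- The vertex `3i + 1` of the `i`-th triangle, which is adjacent to the hub. -/
def leftVertex (i : Fin k) : Fin (3 * k + e + 1) := ⟨3 * i + 1, by omega⟩

variable (e) in
/-- The vertex `3i + 2` of the `i`-th triangle, which is adjacent to the last vertex of the
previous triangle. -/
def rightVertex (i : Fin k) : Fin (3 * k + e + 1) := ⟨3 * i + 2, by omega⟩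

variable (e) in
/-- The vertex `3j`: the hub for `j = 0` and the last vertex of the triangle `j - 1` otherwise. -/
def apex (j : Fin (k + 1)) : Fin (3 * k + e + 1) := ⟨3 * j, by omega⟩

variable (e) in
/-- The vertex set of the `i`-th triangle of the chain. -/
def triangle (i : Fin k) : Set (Fin (3 * k + e + 1)) :=
  {leftVertex e i, rightVertex e i, apex e i.succ}

theorem mem_triangle_iff {i : Fin k} {v : Fin (3 * k + e + 1)} :
    v ∈ triangle e i ↔ 3 * (i : ℕ) < v ∧ (v : ℕ) ≤ 3 * i + 3 := by
  simp only [triangle, Set.mem_insert_iff, Set.mem_singleton_iff, Fin.ext_iff, leftVertex,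
    rightVertex, apex, Fin.val_succ]
  omega

theorem mem_triangle_of_adj_leftVertex {i : Fin k} {v : Fin (3 * k + e + 1)}
    (h : (chainGraph k e).Adj (leftVertex e i) v) (hv : v ≠ apex e 0) :
    v ∈ triangle e i := by
  rw [mem_triangle_iff]
  rw [Ne, Fin.ext_iff] at hv
  simp only [apex, Fin.val_zero] at hv
  obtain hlt | hlt := h.ne.lt_or_gt
  · rw [chainGraph_adj_iff hlt] at h
    simp only [leftVertex] at h
    omega
  · rw [SimpleGraph.adj_comm, chainGraph_adj_iff hlt] at h
    simp only [leftVertex] at h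
    omega

theorem mem_triangle_of_adj_rightVertex {i : Fin k} {v : Fin (3 * k + e + 1)}
    (h : (chainGraph k e).Adj (rightVertex e i) v) (hv : v ≠ apex e i.castSucc) :
    v ∈ triangle e i := by
  rw [mem_triangle_iff]
  rw [Ne, Fin.ext_iff] at hv
  simp only [apex, Fin.val_castSucc] at hv
  obtain hlt | hlt := h.ne.lt_or_gt
  · rw [chainGraph_adj_iff hlt] at h
    simp only [rightVertex] at h
    omega
  · rw [SimpleGraph.adj_comm, chainGraph_adj_iff hlt] at h
    simp only [rightVertex] at h
    omega

theorem mem_triangle_or_eq_rightVertex_of_adj_apex {i : Fin k} {v : Fin (3 * k + e + 1)}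
    (h : (chainGraph k e).Adj (apex e i.succ) v) (hi : 0 < (i : ℕ)) :
    v ∈ triangle e i ∨ ∃ j : Fin k, (i : ℕ) + 1 = j ∧ v = rightVertex e j := by
  rw [mem_triangle_iff, or_iff_not_imp_right]
  intro hv
  obtain hlt | hlt := h.ne.lt_or_gt
  · rw [chainGraph_adj_iff hlt] at h
    simp only [apex, Fin.val_succ] at h
    exact absurd ⟨⟨i + 1, by omega⟩, rfl, Fin.ext (by simp only [rightVertex]; omega)⟩ hv
  · rw [SimpleGraph.adj_comm, chainGraph_adj_iff hlt] at h
    simp only [apex, Fin.val_succ] at h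
    omega

variable (k e) in
/-- The coordinates of the points of the configuration `chainGram` along the vector they share. -/
noncomputable def axisVec : Fin (3 * k + e + 1) → ℝ :=
  fun v => if (v : ℕ) ≤ 3 * k ∧ (v : ℕ) % 3 ≠ 0 then -1 / 2 else 1

variable (e) in
/-- The coordinates of the points of the configuration `chainGram` along the direction proper to the
`i`-th triangle, up to the factor `√3 / 2`. -/
noncomputable def spinVec (i : Fin k) : Fin (3 * k + e + 1) → ℝ :=
  Pi.single (leftVertex e i) 1 - Pi.single (rightVertex e i) 1

variable (e) in
/-- The restriction of the axis vector to the `i`-th triangle. No feasible matrix has it in its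
range, but excluding it takes more than `i` facial reduction steps. -/
noncomputable def flexVec (i : Fin k) : Fin (3 * k + e + 1) → ℝ :=
  (triangle e i).indicator (axisVec k e)

theorem axisVec_leftVertex (i : Fin k) : axisVec k e (leftVertex e i) = -1 / 2 := by
  rw [axisVec, if_pos (by simp only [leftVertex]; omega)]

theorem axisVec_rightVertex (i : Fin k) : axisVec k e (rightVertex e i) = -1 / 2 := by
  rw [axisVec, if_pos (by simp only [rightVertex]; omega)]

theorem axisVec_apex (j : Fin (k + 1)) : axisVec k e (apex e j) = 1 := by
  rw [axisVec, if_neg (by simp only [apex]; omega)]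

theorem spinVec_leftVertex (i j : Fin k) :
    spinVec e i (leftVertex e j) = if i = j then 1 else 0 := by
  have hr : leftVertex e j ≠ rightVertex e i := by
    simp only [Ne, Fin.ext_iff, leftVertex, rightVertex]; omega
  have hl : leftVertex e j = leftVertex e i ↔ i = j := by
    simp only [Fin.ext_iff, leftVertex]; omega
  simp only [spinVec, Pi.sub_apply, Pi.single_apply, hr, hl, if_false, sub_zero]

theorem spinVec_rightVertex (i j : Fin k) :
    spinVec e i (rightVertex e j) = if i = j then -1 else 0 := by
  have hl : rightVertex e j ≠ leftVertex e i := by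
    simp only [Ne, Fin.ext_iff, leftVertex, rightVertex]; omega
  have hr : rightVertex e j = rightVertex e i ↔ i = j := by
    simp only [Fin.ext_iff, rightVertex]; omega
  simp only [spinVec, Pi.sub_apply, Pi.single_apply, hr, hl, if_false, zero_sub]
  split_ifs <;> simp

theorem spinVec_eq_zero (i : Fin k) {v : Fin (3 * k + e + 1)} (hl : v ≠ leftVertex e i)
    (hr : v ≠ rightVertex e i) : spinVec e i v = 0 := by
  simp only [spinVec, Pi.sub_apply, Pi.single_apply, hl, hr, if_false, sub_zero]

theorem spinVec_apex (i : Fin k) (j : Fin (k + 1)) : spinVec e i (apex e j) = 0 := by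
  refine spinVec_eq_zero i ?_ ?_ <;>
  simp only [Ne, Fin.ext_iff, leftVertex, rightVertex, apex] <;> omega

theorem eq_leftVertex_or_eq_rightVertex_or (v : Fin (3 * k + e + 1)) :
    (∃ i, v = leftVertex e i) ∨ (∃ i, v = rightVertex e i) ∨
      axisVec k e v = 1 ∧ ∀ i, spinVec e i v = 0 := by
  by_cases hl : ∃ i, v = leftVertex e i
  · exact .inl hl
  by_cases hr : ∃ i, v = rightVertex e i
  · exact .inr (.inl hr)
  refine .inr (.inr ⟨if_neg fun hv => ?_, fun i => spinVec_eq_zero i (fun h => hl ⟨i, h⟩)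
    fun h => hr ⟨i, h⟩⟩)
  obtain h | h : (v : ℕ) % 3 = 1 ∨ (v : ℕ) % 3 = 2 := by omega
  · exact hl ⟨⟨v / 3, by omega⟩, Fin.ext (by simp only [leftVertex]; omega)⟩
  · exact hr ⟨⟨v / 3, by omega⟩, Fin.ext (by simp only [rightVertex]; omega)⟩

variable (k e) in
/-- The vectors whose outer products add up to `chainGram`. -/
noncomputable def chainFactor : Option (Fin k) → Fin (3 * k + e + 1) → ℝ
  | none => axisVec k e
  | some i => (√3 / 2) • spinVec e i

variable (k e) in
/-- The Gram matrix of the configuration in which the vertices `3j` and the isolated ones all sit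
at the same unit vector `p`, while the first two vertices of each triangle form an equilateral
triangle with `p` in a plane through `p` of their own. -/
noncomputable def chainGram : Matrix (Fin (3 * k + e + 1)) (Fin (3 * k + e + 1)) ℝ :=
  ∑ a, vecMulVec (chainFactor k e a) (chainFactor k e a)

theorem chainGram_apply (u v : Fin (3 * k + e + 1)) :
    chainGram k e u v = axisVec k e u * axisVec k e v +
      3 / 4 * ∑ i, spinVec e i u * spinVec e i v := by
  simp only [chainGram, Fintype.sum_option, Matrix.sum_apply, vecMulVec_apply,
    chainFactor, Pi.smul_apply, smul_eq_mul, Finset.mul_sum]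
  congr 1
  refine Finset.sum_congr rfl fun i _ => ?_
  linear_combination (spinVec e i u * spinVec e i v / 4) * Real.sq_sqrt (zero_le_three (α := ℝ))

theorem chainGram_leftVertex (i : Fin k) (v : Fin (3 * k + e + 1)) :
    chainGram k e (leftVertex e i) v = -1 / 2 * axisVec k e v + 3 / 4 * spinVec e i v := by
  simp only [chainGram_apply, axisVec_leftVertex, spinVec_leftVertex, ite_mul, one_mul, zero_mul,
    Finset.sum_ite_eq', Finset.mem_univ, if_true]

theorem chainGram_rightVertex (i : Fin k) (v : Fin (3 * k + e + 1)) :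
    chainGram k e (rightVertex e i) v = -1 / 2 * axisVec k e v - 3 / 4 * spinVec e i v := by
  simp only [chainGram_apply, axisVec_rightVertex, spinVec_rightVertex, ite_mul, neg_mul, one_mul,
    zero_mul, Finset.sum_ite_eq', Finset.mem_univ, if_true, mul_neg, sub_eq_add_neg]

theorem chainGram_diag (v : Fin (3 * k + e + 1)) : chainGram k e v v = 1 := by
  obtain ⟨i, rfl⟩ | ⟨i, rfl⟩ | ⟨haxis, hspin⟩ := eq_leftVertex_or_eq_rightVertex_or v
  · rw [chainGram_leftVertex, axisVec_leftVertex, spinVec_leftVertex, if_pos rfl]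
    norm_num
  · rw [chainGram_rightVertex, axisVec_rightVertex, spinVec_rightVertex, if_pos rfl]
    norm_num
  · simp [chainGram_apply, haxis, hspin]

theorem chainGram_leftVertex_rightVertex (i : Fin k) :
    chainGram k e (leftVertex e i) (rightVertex e i) = -1 / 2 := by
  rw [chainGram_leftVertex, axisVec_rightVertex, spinVec_rightVertex, if_pos rfl]
  norm_num

theorem chainGram_leftVertex_apex (i : Fin k) (j : Fin (k + 1)) :
    chainGram k e (leftVertex e i) (apex e j) = -1 / 2 := by
  rw [chainGram_leftVertex, axisVec_apex, spinVec_apex]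
  norm_num

theorem chainGram_rightVertex_apex (i : Fin k) (j : Fin (k + 1)) :
    chainGram k e (rightVertex e i) (apex e j) = -1 / 2 := by
  rw [chainGram_rightVertex, axisVec_apex, spinVec_apex]
  norm_num

variable (k e) in
/-- The edge weights of the configuration `chainGram`. -/
noncomputable def chainWeight : (chainGraph k e).edgeSet → ℝ :=
  fun a => entries (chainGraph k e) (chainGram k e) (Sum.inr a)

theorem chainGram_mem_feasibleSet :
    chainGram k e ∈ feasibleSet (chainGraph k e) (chainWeight k e) := by
  refine mem_feasibleSet_iff.2 ⟨?_, funext fun a => ?_⟩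
  · exact posSemidef_sum _ fun a _ => by
      simpa using posSemidef_vecMulVec_self_star (chainFactor k e a)
  · cases a with
    | inl v => exact (entries_inl _ v).trans (chainGram_diag v)
    | inr a => rfl

theorem mem_of_reducesTo_chainWeight {m : ℕ} {W : Submodule ℝ (Fin (3 * k + e + 1) → ℝ)}
    (hW : ReducesTo (chainGraph k e) (chainWeight k e) m W) :
    axisVec k e ∈ W ∧ ∀ i, spinVec e i ∈ W := by
  have hmem := hW.mem_of_sum_vecMulVec_mem chainGram_mem_feasibleSet
  exact ⟨hmem none, fun i => (W.smul_mem_iff (by positivity)).1 (hmem (some i))⟩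

theorem chainGraph_adj_leftVertex_rightVertex (i : Fin k) :
    (chainGraph k e).Adj (leftVertex e i) (rightVertex e i) := by
  have hlt : leftVertex e i < rightVertex e i := by simp [Fin.lt_def, leftVertex, rightVertex]
  rw [chainGraph_adj_iff hlt]
  simp only [leftVertex, rightVertex, true_or, and_true]
  omega

theorem chainGraph_adj_leftVertex_apex_succ (i : Fin k) :
    (chainGraph k e).Adj (leftVertex e i) (apex e i.succ) := by
  have hlt : leftVertex e i < apex e i.succ :=
    Fin.lt_def.2 (by simp only [leftVertex, apex, Fin.val_succ]; omega)
  rw [chainGraph_adj_iff hlt]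
  simp only [leftVertex, apex, Fin.val_succ]
  omega

theorem chainGraph_adj_rightVertex_apex_succ (i : Fin k) :
    (chainGraph k e).Adj (rightVertex e i) (apex e i.succ) := by
  have hlt : rightVertex e i < apex e i.succ :=
    Fin.lt_def.2 (by simp only [rightVertex, apex, Fin.val_succ]; omega)
  rw [chainGraph_adj_iff hlt]
  simp only [rightVertex, apex, Fin.val_succ]
  omega

theorem chainGraph_adj_leftVertex_hub (i : Fin k) :
    (chainGraph k e).Adj (leftVertex e i) (apex e 0) := by
  have hlt : apex e 0 < leftVertex e i := by simp [Fin.lt_def, leftVertex, apex]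
  rw [SimpleGraph.adj_comm, chainGraph_adj_iff hlt]
  simp only [leftVertex, apex, Fin.val_zero, true_and]
  omega

theorem chainGraph_adj_rightVertex_apex_castSucc (i : Fin k) :
    (chainGraph k e).Adj (rightVertex e i) (apex e i.castSucc) := by
  have hlt : apex e i.castSucc < rightVertex e i := by simp [Fin.lt_def, rightVertex, apex]
  rw [SimpleGraph.adj_comm, chainGraph_adj_iff hlt]
  simp only [rightVertex, apex, Fin.val_castSucc, and_true]
  omega

theorem row_add_row_add_row_eq_zero {V : Type*} [Fintype V] {X : Matrix V V ℝ}
    (hX : X ∈ elliptope V) {p q r : V} (hpq : X p q = -1 / 2) (hpr : X p r = -1 / 2)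
    (hqr : X q r = -1 / 2) : X p + X q + X r = 0 := by
  have hsymm := isSymm_of_posSemidef hX.1
  have hqp := (hsymm.apply p q).trans hpq
  have hrp := (hsymm.apply p r).trans hpr
  have hrq := (hsymm.apply q r).trans hqr
  have hker : X *ᵥ (Pi.single p 1 + Pi.single q 1 + Pi.single r 1) = 0 := by
    rw [← hX.1.dotProduct_mulVec_zero_iff, star_trivial]
    simp only [mulVec_add, mulVec_single_one, add_dotProduct, single_one_dotProduct, Pi.add_apply,
      col_apply, hX.2, hpq, hpr, hqr, hqp, hrp, hrq]
    norm_num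
  rw [← hsymm.eq, mulVec_transpose] at hker
  rwa [add_vecMul, add_vecMul, single_one_vecMul, single_one_vecMul, single_one_vecMul] at hker

theorem row_apex_eq_of_mem_feasibleSet
    {X : Matrix (Fin (3 * k + e + 1)) (Fin (3 * k + e + 1)) ℝ}
    (hX : X ∈ feasibleSet (chainGraph k e) (chainWeight k e)) (j : Fin (k + 1)) :
    X (apex e j) = X (apex e 0) := by
  have hsymm := isSymm_of_posSemidef hX.1.1
  have hedge {u v} (h : (chainGraph k e).Adj u v) : X u v = chainGram k e u v :=
    (hX.2 u v h).trans (chainGram_mem_feasibleSet.2 u v h).symm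
  induction j using Fin.induction with
  | zero => rfl
  | succ i ih =>
    have hlr := (hedge (chainGraph_adj_leftVertex_rightVertex i)).trans
      (chainGram_leftVertex_rightVertex i)
    have htriangle := row_add_row_add_row_eq_zero hX.1 hlr
      ((hedge (chainGraph_adj_leftVertex_apex_succ i)).trans (chainGram_leftVertex_apex i _))
      ((hedge (chainGraph_adj_rightVertex_apex_succ i)).trans (chainGram_rightVertex_apex i _))
    have hright_hub : X (rightVertex e i) (apex e 0) = -1 / 2 := by
      rw [← hsymm.apply, ← ih, hsymm.apply, hedge (chainGraph_adj_rightVertex_apex_castSucc i),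
        chainGram_rightVertex_apex]
    have hhub := row_add_row_add_row_eq_zero hX.1 hlr
      ((hedge (chainGraph_adj_leftVertex_hub i)).trans (chainGram_leftVertex_apex i _)) hright_hub
    exact add_left_cancel (htriangle.trans hhub.symm)

theorem apex_zero_notMem_triangle (i : Fin k) : apex e 0 ∉ triangle e i := by
  simp [mem_triangle_iff, apex]

theorem apex_castSucc_notMem_triangle (i : Fin k) : apex e i.castSucc ∉ triangle e i := by
  simp [mem_triangle_iff, apex]

theorem flexVec_apex_succ (i : Fin k) : flexVec e i (apex e i.succ) = 1 :=
  (Set.indicator_of_mem (by simp [triangle]) _).trans (axisVec_apex _)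

theorem flexVec_notMem_range {X : Matrix (Fin (3 * k + e + 1)) (Fin (3 * k + e + 1)) ℝ}
    (hX : X ∈ feasibleSet (chainGraph k e) (chainWeight k e)) (i : Fin k) :
    flexVec e i ∉ LinearMap.range X.mulVecLin := by
  rintro ⟨y, hy⟩
  have hrow : (X *ᵥ y) (apex e i.succ) = (X *ᵥ y) (apex e 0) :=
    congrArg (· ⬝ᵥ y) (row_apex_eq_of_mem_feasibleSet hX i.succ)
  rw [mulVecLin_apply] at hy
  rw [hy, flexVec_apex_succ, flexVec,
    Set.indicator_of_notMem (apex_zero_notMem_triangle i)] at hrow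
  exact one_ne_zero hrow

theorem stressMatrix_mulVec_apply {V : Type*} [Fintype V] {G : SimpleGraph V}
    (ω : V ⊕ G.edgeSet → ℝ) {x : V → ℝ} {p q : V}
    (h : ∀ r ≠ q, r = p ∨ G.Adj p r → stressMatrix G ω p r * x r = 0) :
    (stressMatrix G ω *ᵥ x) p = stressMatrix G ω p q * x q := by
  refine Finset.sum_eq_single q (fun r _ hr => ?_) (by simp)
  by_cases hpr : r = p ∨ G.Adj p r
  · exact h r hr hpr
  · rw [not_or] at hpr
    exact mul_eq_zero_of_left (stressMatrix_apply_eq_zero ω (Ne.symm hpr.1) hpr.2) _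

section Stresses

variable (ω : Fin (3 * k + e + 1) ⊕ (chainGraph k e).edgeSet → ℝ)

local notation "Ω" => stressMatrix (chainGraph k e) ω

theorem spinVec_dotProduct (i : Fin k) (x : Fin (3 * k + e + 1) → ℝ) :
    spinVec e i ⬝ᵥ x = x (leftVertex e i) - x (rightVertex e i) := by
  simp only [spinVec, sub_dotProduct, single_one_dotProduct]

theorem stressMatrix_mulVec_compl_rightVertex (i : Fin k) :
    (Ω *ᵥ (triangle e i)ᶜ.indicator (axisVec k e)) (rightVertex e i) =
      Ω (rightVertex e i) (apex e i.castSucc) := by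
  rw [stressMatrix_mulVec_apply ω (q := apex e i.castSucc), Set.indicator_of_mem
    (apex_castSucc_notMem_triangle i), axisVec_apex, mul_one]
  rintro r hr (rfl | h) <;> refine mul_eq_zero_of_right _ (Set.indicator_of_notMem ?_ _)
  · simp [triangle]
  · exact not_not_intro (mem_triangle_of_adj_rightVertex h hr)

theorem stressMatrix_mulVec_compl_apex {i : Fin k} (hi : 0 < (i : ℕ))
    (hnext : ∀ j : Fin k, (i : ℕ) + 1 = j → Ω (apex e i.succ) (rightVertex e j) = 0) :
    (Ω *ᵥ (triangle e i)ᶜ.indicator (axisVec k e)) (apex e i.succ) = 0 := by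
  have hmem : apex e i.succ ∈ triangle e i := by simp [triangle]
  rw [stressMatrix_mulVec_apply ω (q := apex e i.succ),
    Set.indicator_of_notMem (not_not_intro hmem), mul_zero]
  rintro r hr (rfl | h)
  · exact absurd rfl hr
  · obtain hmem | ⟨j, hj, rfl⟩ := mem_triangle_or_eq_rightVertex_of_adj_apex h hi
    · exact mul_eq_zero_of_right _ (Set.indicator_of_notMem (not_not_intro hmem) _)
    · exact mul_eq_zero_of_left (hnext j hj) _

theorem spinVec_dotProduct_mulVec_flexVec {i j : Fin k} (hij : (i : ℕ) + 1 = j) :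
    spinVec e j ⬝ᵥ (Ω *ᵥ flexVec e i) = -Ω (rightVertex e j) (apex e j.castSucc) := by
  have hapex : apex e j.castSucc = apex e i.succ := by
    simp [apex, ← hij]
  have hout {r} (hr : r ∈ triangle e j) : flexVec e i r = 0 := by
    refine Set.indicator_of_notMem ?_ _
    rw [mem_triangle_iff] at hr ⊢
    omega
  have hleft : (Ω *ᵥ flexVec e i) (leftVertex e j) = 0 := by
    rw [stressMatrix_mulVec_apply ω (q := apex e 0), flexVec,
      Set.indicator_of_notMem (apex_zero_notMem_triangle i), mul_zero]
    rintro r hr (rfl | h) <;> refine mul_eq_zero_of_right _ (hout ?_)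
    · simp [triangle]
    · exact mem_triangle_of_adj_leftVertex h hr
  have hright : (Ω *ᵥ flexVec e i) (rightVertex e j) = Ω (rightVertex e j) (apex e j.castSucc) := by
    rw [stressMatrix_mulVec_apply ω (q := apex e j.castSucc), hapex, flexVec_apex_succ, mul_one]
    rintro r hr (rfl | h) <;> refine mul_eq_zero_of_right _ (hout ?_)
    · simp [triangle]
    · exact mem_triangle_of_adj_rightVertex h hr
  rw [spinVec_dotProduct, hleft, hright, zero_sub]

variable {ω} {W : Submodule ℝ (Fin (3 * k + e + 1) → ℝ)}

theorem stressMatrix_rightVertex_apex_eq_zero {i j : Fin k} (hij : (i : ℕ) + 1 = j)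
    (hspin : ∀ w ∈ W, spinVec e j ⬝ᵥ (Ω *ᵥ w) = 0) (hi : flexVec e i ∈ W) :
    Ω (rightVertex e j) (apex e j.castSucc) = 0 := by
  rw [← neg_eq_zero, ← spinVec_dotProduct_mulVec_flexVec ω hij, hspin _ hi]

theorem flexVec_isotropic {i j : Fin k} (hij : (i : ℕ) + 1 = j)
    (haxis : ∀ w ∈ W, axisVec k e ⬝ᵥ (Ω *ᵥ w) = 0)
    (hspin : ∀ l, ∀ w ∈ W, spinVec e l ⬝ᵥ (Ω *ᵥ w) = 0)
    (haxis_mem : axisVec k e ∈ W) (hi : flexVec e i ∈ W) (hj : flexVec e j ∈ W) :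
    flexVec e j ⬝ᵥ (Ω *ᵥ flexVec e j) = 0 := by
  have hcompl : (triangle e j)ᶜ.indicator (axisVec k e) = axisVec k e - flexVec e j :=
    Set.indicator_compl _ _
  have hright : (Ω *ᵥ (triangle e j)ᶜ.indicator (axisVec k e)) (rightVertex e j) = 0 :=
    (stressMatrix_mulVec_compl_rightVertex ω j).trans
      (stressMatrix_rightVertex_apex_eq_zero hij (hspin j) hi)
  have hleft : (Ω *ᵥ (triangle e j)ᶜ.indicator (axisVec k e)) (leftVertex e j) = 0 := by
    have h := hspin j _ (hcompl ▸ W.sub_mem haxis_mem hj)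
    rwa [spinVec_dotProduct, hright, sub_zero] at h
  have hapex : (Ω *ᵥ (triangle e j)ᶜ.indicator (axisVec k e)) (apex e j.succ) = 0 := by
    refine stressMatrix_mulVec_compl_apex ω (by omega) fun l hl => ?_
    have hsucc : apex e l.castSucc = apex e j.succ := by simp [apex, ← hl]
    rw [← (isSymm_stressMatrix ω).apply, ← hsucc,
      stressMatrix_rightVertex_apex_eq_zero hl (hspin l) hj]
  have hflex_compl : flexVec e j ⬝ᵥ (Ω *ᵥ (triangle e j)ᶜ.indicator (axisVec k e)) = 0 := by
    refine Finset.sum_eq_zero fun v _ => ?_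
    by_cases hv : v ∈ triangle e j
    · obtain rfl | rfl | rfl := hv <;> exact mul_eq_zero_of_right _ ‹_›
    · exact mul_eq_zero_of_left (Set.indicator_of_notMem hv _) _
  rw [hcompl, mulVec_sub, dotProduct_sub,
    dotProduct_mulVec_comm_of_isSymm (isSymm_stressMatrix ω) _ (axisVec k e), haxis _ hj,
    zero_sub, neg_eq_zero] at hflex_compl
  exact hflex_compl

end Stresses

theorem flexVec_mem_of_reducesTo {m : ℕ} {W : Submodule ℝ (Fin (3 * k + e + 1) → ℝ)}
    (hW : ReducesTo (chainGraph k e) (chainWeight k e) m W) {i : Fin k} (hi : m ≤ i) :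
    flexVec e i ∈ W := by
  induction hW generalizing i with
  | zero => trivial
  | @succ m W W' hW ω nonneg hd mem_iff ih =>
    obtain ⟨haxis, hspin⟩ := mem_of_reducesTo_chainWeight (hW.succ ω nonneg hd mem_iff)
    have radical {v} (hv : v ∈ W') {w} (hw : w ∈ W) :
        v ⬝ᵥ (stressMatrix (chainGraph k e) ω *ᵥ w) = 0 :=
      dotProduct_mulVec_eq_zero_of_isotropic (isSymm_stressMatrix ω) nonneg ((mem_iff v).1 hv).1
        ((mem_iff v).1 hv).2 hw
    let i' : Fin k := ⟨i - 1, by omega⟩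
    have hi' : (i' : ℕ) + 1 = i := Nat.sub_add_cancel (by omega)
    refine (mem_iff _).2 ⟨ih (by omega), ?_⟩
    exact flexVec_isotropic hi' (fun w => radical haxis) (fun l w => radical (hspin l))
      ((mem_iff _).1 haxis).1 (ih (by omega)) (ih (by omega))

theorem le_sd_chainGraph : k ≤ sd (chainGraph k e) := by
  have hc : chainWeight k e ∈ coordinateShadow (chainGraph k e) := ⟨_, chainGram_mem_feasibleSet⟩
  refine (le_sdWeight hc fun m X hX hred => ?_).trans (sdWeight_le_sd hc)
  by_contra! hm
  exact flexVec_notMem_range hX ⟨m, hm⟩ (flexVec_mem_of_reducesTo hred le_rfl)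

end Chain

theorem exists_treewidth_eq_three_le_sd {n : ℕ} (hn : 4 ≤ n) :
    ∃ G : SimpleGraph (Fin n), treewidth G = 3 ∧ (n - 1) / 3 ≤ sd G := by
  obtain ⟨e, he⟩ : ∃ e, n = 3 * ((n - 1) / 3) + e + 1 := ⟨(n - 1) % 3, by omega⟩
  have hk : 0 < (n - 1) / 3 := by omega
  generalize (n - 1) / 3 = k at *
  subst he
  exact ⟨chainGraph k e, treewidth_chainGraph hk, le_sd_chainGraph⟩

end PSDCompletion

theorem corollary7p2 :
    (∀ n : ℕ, 4 ≤ n → ∃ G : SimpleGraph (Fin n),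
      PSDCompletion.treewidth G = 3 ∧ (n - 1) / 3 ≤ PSDCompletion.sd G) ∧
    ¬ ∃ f : ℕ → ℝ,
      Asymptotics.IsLittleO Filter.atTop f (fun n : ℕ => (n : ℝ)) ∧
      ∀ (n : ℕ) (G : SimpleGraph (Fin n)), (PSDCompletion.sd G : ℝ) ≤ f n := by
  refine ⟨fun n => PSDCompletion.exists_treewidth_eq_three_le_sd, ?_⟩
  rintro ⟨f, hf, hsd⟩
  obtain ⟨n, hfn, hn⟩ :=
    ((hf.def (c := 1 / 10) (by norm_num)).and (Filter.eventually_ge_atTop 10)).exists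
  obtain ⟨G, -, hG⟩ := PSDCompletion.exists_treewidth_eq_three_le_sd (n := n) (by omega)
  have hlower : (n : ℝ) ≤ 3 * PSDCompletion.sd G + 3 := by
    exact_mod_cast (by omega : n ≤ 3 * PSDCompletion.sd G + 3)
  have hupper : f n ≤ 1 / 10 * n := by
    simpa using (le_abs_self (f n)).trans hfn
  have hn' : (10 : ℝ) ≤ n := by exact_mod_cast hn
  linarith [hsd n G]
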